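/- Let $n,r,k\ge 0$ be integers and let $\mathbb{M}_n=\{x\in\mathbb{R}^{n+1}: \langle x,x\rangle=1,\ x_0>0\}$, where $\langle x,y\rangle=x_0y_0-\sum_{i=1}^n x_iy_i$, be the hyperboloid model of $n$-dimensional hyperbolic space, with distance $d_H(x,y)=\operatorname{arcosh}\langle x,y\rangle$. A nonempty set $S\subseteq\mathbb{M}_n$ is a *geodesic submanifold of dimension $r$* if it contains the complete geodesic line through any two distinct points of $S$, and if for each $p\in S$ the velocities at $p$ of the geodesics through $p$ contained in $S$ span an $r$-dimensional space. The set $S$ is an *$r$-dimensional geodesic submanifold centered (rooted) at* $m\in\mathbb{M}_n$ if there is an $r$-dimensional linear subspace $T$ of the tangent space of $\mathbb{M}_n$ at $m$ such that $S$ is the union of all geodesics through $m$ with velocity at $m$ in $T$ (the zero velocity giving the constant geodesic). A *Karcher (Fréchet) mean* of points $x_1,\dots,x_k\in\mathbb{M}_n$ is a global minimizer over $z\in\mathbb{M}_n$ of $\sum_{i=1}^k d_H(x_i,z)^2$, and a *pseudo-Euclidean mean* is a global minimizer over $z\in\mathbb{M}_n$ of $\sum_{i=1}^k\sinh^2 d_H(x_i,z)$.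 **Lemma.** Let $S\subseteq\mathbb{M}_n$ be a geodesic submanifold of dimension $r$ and let $x_1,\dots,x_k\in S$. Then 1. some Karcher mean $m$ of $x_1,\dots,x_k$ lies in $S$, and $S$ is an $r$-dimensional geodesic submanifold centered at $m$; 2. some pseudo-Euclidean mean $m$ of $x_1,\dots,x_k$ lies in $S$, and $S$ is an $r$-dimensional geodesic submanifold centered at $m$; 3. if $k\ge 1$, then every local minimizer $m\in\mathbb{M}_n$ of either of the two variances above (in particular every Karcher mean and every pseudo-Euclidean mean) lies in $S$, and $S$ is an $r$-dimensional geodesic submanifold centered at $m$. -/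

import Mathlib

namespace Hyperboloid

/-- The Lorentzian form `xᵀ Q y = x₀ y₀ - x₁ y₁ - ⋯ - xₙ yₙ` on `ℝⁿ⁺¹`. -/
def lorentz {n : ℕ} (x y : Fin (n + 1) → ℝ) : ℝ :=
  x 0 * y 0 - ∑ i : Fin n, x i.succ * y i.succ

/-- The hyperboloid model of `n`-dimensional hyperbolic space. -/
def space (n : ℕ) : Set (Fin (n + 1) → ℝ) :=
  {x | lorentz x x = 1 ∧ 0 < x 0}

/-- The hyperbolic distance, `cosh (d_H x y) = xᵀ Q y`. -/
noncomputable def hdist {n : ℕ} (x y : Fin (n + 1) → ℝ) : ℝ :=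
  Real.arcosh (lorentz x y)

/-- The tangent space of the hyperboloid at `p`, as a linear subspace of `ℝⁿ⁺¹`. -/
def tangentSpace {n : ℕ} (p : Fin (n + 1) → ℝ) : Submodule ℝ (Fin (n + 1) → ℝ) where
  carrier := {v | lorentz p v = 0}
  zero_mem' := by simp [lorentz]
  add_mem' := by
    intro v w hv hw
    simp only [Set.mem_ofPred_eq, lorentz, Pi.add_apply, mul_add, Finset.sum_add_distrib] at *
    linarith
  smul_mem' := by
    intro c v hv
    simp only [Set.mem_ofPred_eq, lorentz, Pi.smul_apply, smul_eq_mul, mul_left_comm _ c,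
      ← Finset.mul_sum, ← mul_sub] at *
    rw [hv, mul_zero]

/-- The Riemannian length of a tangent vector; the form is negative definite on tangent spaces. -/
noncomputable def tangentNorm {n : ℕ} (v : Fin (n + 1) → ℝ) : ℝ :=
  Real.sqrt (-lorentz v v)

/-- The geodesic with initial point `p` and initial velocity `v`
(the constant curve at `p` when `v = 0`). -/
noncomputable def geodesic {n : ℕ} (p v : Fin (n + 1) → ℝ) (t : ℝ) : Fin (n + 1) → ℝ :=
  Real.cosh (tangentNorm v * t) • p + (Real.sinh (tangentNorm v * t) / tangentNorm v) • v

/-- Complete geodesic lines of hyperbolic space. -/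
def IsGeodesicLine {n : ℕ} (L : Set (Fin (n + 1) → ℝ)) : Prop :=
  ∃ p ∈ space n, ∃ v ∈ tangentSpace p, v ≠ 0 ∧ L = Set.range (geodesic p v)

/-- The tangent space at `p` of a set `S`: the span of the velocities at `p` of the geodesics
through `p` that lie in `S`. -/
def tangentSpaceOf {n : ℕ} (S : Set (Fin (n + 1) → ℝ)) (p : Fin (n + 1) → ℝ) :
    Submodule ℝ (Fin (n + 1) → ℝ) :=
  Submodule.span ℝ {v | v ∈ tangentSpace p ∧ ∀ t : ℝ, geodesic p v t ∈ S}

/-- `S` is a geodesic submanifold of dimension `r`: a nonempty subset of hyperbolic space that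
contains the complete geodesic through any two distinct points of it, and whose tangent spaces
have dimension `r`. -/
structure IsGeodesicSubmanifold {n : ℕ} (r : ℕ) (S : Set (Fin (n + 1) → ℝ)) : Prop where
  subset_space : S ⊆ space n
  nonempty : S.Nonempty
  line_subset : ∀ x ∈ S, ∀ y ∈ S, x ≠ y →
    ∀ L : Set (Fin (n + 1) → ℝ), IsGeodesicLine L → x ∈ L → y ∈ L → L ⊆ S
  finrank_tangentSpaceOf : ∀ p ∈ S, Module.finrank ℝ (tangentSpaceOf S p) = r

/-- `S` is the `r`-dimensional geodesic submanifold rooted (centered) at the point `m`: the union of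
all geodesics through `m` whose velocity at `m` lies in some fixed `r`-dimensional subspace `T` of
the tangent space at `m`. -/
def IsRootedAt {n : ℕ} (r : ℕ) (S : Set (Fin (n + 1) → ℝ)) (m : Fin (n + 1) → ℝ) : Prop :=
  m ∈ space n ∧ ∃ T : Submodule ℝ (Fin (n + 1) → ℝ), T ≤ tangentSpace m ∧
    Module.finrank ℝ T = r ∧ S = ⋃ v ∈ T, Set.range (geodesic m v)

/-- The Fréchet variance of the points `x i`, as a function of `z`. -/
noncomputable def frechetVariance {n k : ℕ} (x : Fin k → Fin (n + 1) → ℝ)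
    (z : Fin (n + 1) → ℝ) : ℝ :=
  ∑ i, hdist (x i) z ^ 2

/-- The pseudo-Euclidean variance of the points `x i`, as a function of `z`. -/
noncomputable def pseudoEuclideanVariance {n k : ℕ} (x : Fin k → Fin (n + 1) → ℝ)
    (z : Fin (n + 1) → ℝ) : ℝ :=
  ∑ i, Real.sinh (hdist (x i) z) ^ 2

/-- `m` is a Karcher (Fréchet) mean: a global minimizer of the Fréchet variance. -/
def IsKarcherMean {n k : ℕ} (x : Fin k → Fin (n + 1) → ℝ) (m : Fin (n + 1) → ℝ) : Prop :=
  m ∈ space n ∧ IsMinOn (frechetVariance x) (space n) m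

/-- `m` is a pseudo-Euclidean mean: a global minimizer of the pseudo-Euclidean variance. -/
def IsPseudoEuclideanMean {n k : ℕ} (x : Fin k → Fin (n + 1) → ℝ)
    (m : Fin (n + 1) → ℝ) : Prop :=
  m ∈ space n ∧ IsMinOn (pseudoEuclideanVariance x) (space n) m

end Hyperboloid

namespace Hyperboloid

open Set Filter Topology

variable {n : ℕ}

/-! The line through two points of the hyperboloid is its section by the plane they span, so a
geodesic submanifold `S` is the section by a linear subspace `U` (`exists_submodule`). Its tangent
space at any `m ∈ S` is then `U ⊓ tangentSpace m`, and `S` is rooted at each of its points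
(`isRootedAt`). It remains to locate minimizers.

Both variances have the form `∑ i, g (lorentz (x i) z)` with `g` strictly increasing on `[1, ∞)`. If
`m ∉ U`, split `m = u + w` with `u ∈ U` and `w` orthogonal to `U`. Then `w` is spacelike, and
shrinking it slightly and renormalizing gives nearby points with smaller pairing against every point
of `S` (`frequently_lorentz_lt`). So for `k ≥ 1` no local minimizer lies off `S`. Minimizers exist
by coercivity; for `k = 0` any point of `S` is one. -/

theorem lorentz_comm (x y : Fin (n + 1) → ℝ) : lorentz x y = lorentz y x := by
  simp only [lorentz, mul_comm]

theorem lorentz_add_left (x y z : Fin (n + 1) → ℝ) :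
    lorentz (x + y) z = lorentz x z + lorentz y z := by
  simp only [lorentz, Pi.add_apply, add_mul, Finset.sum_add_distrib]
  ring

theorem lorentz_smul_left (c : ℝ) (x z : Fin (n + 1) → ℝ) :
    lorentz (c • x) z = c * lorentz x z := by
  simp only [lorentz, Pi.smul_apply, smul_eq_mul, mul_assoc, ← Finset.mul_sum]
  ring

theorem lorentz_add_right (x y z : Fin (n + 1) → ℝ) :
    lorentz x (y + z) = lorentz x y + lorentz x z := by
  rw [lorentz_comm, lorentz_add_left, lorentz_comm y, lorentz_comm z]

theorem lorentz_smul_right (c : ℝ) (x z : Fin (n + 1) → ℝ) :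
    lorentz x (c • z) = c * lorentz x z := by
  rw [lorentz_comm, lorentz_smul_left, lorentz_comm z]

/-- The Lorentzian form as a bundled bilinear form. -/
def lorentzForm (n : ℕ) : LinearMap.BilinForm ℝ (Fin (n + 1) → ℝ) :=
  LinearMap.mk₂ ℝ lorentz lorentz_add_left lorentz_smul_left lorentz_add_right
    lorentz_smul_right

@[fun_prop]
theorem continuous_lorentz {X : Type*} [TopologicalSpace X] {f g : X → Fin (n + 1) → ℝ}
    (hf : Continuous f) (hg : Continuous g) : Continuous fun a => lorentz (f a) (g a) := by
  unfold lorentz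
  fun_prop

theorem mem_tangentSpace {p v : Fin (n + 1) → ℝ} : v ∈ tangentSpace p ↔ lorentz p v = 0 :=
  Iff.rfl

/-! ### Causal geometry of the future cone -/

/-- The open cone of future-directed timelike vectors. -/
def futureCone (n : ℕ) : Set (Fin (n + 1) → ℝ) :=
  {x | 0 < lorentz x x ∧ 0 < x 0}

theorem space_subset_futureCone : space n ⊆ futureCone n := fun x hx =>
  ⟨by rw [hx.1]; exact one_pos, hx.2⟩

theorem smul_mem_futureCone {x : Fin (n + 1) → ℝ} (hx : x ∈ futureCone n) {c : ℝ} (hc : 0 < c) :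
    c • x ∈ futureCone n := by
  refine ⟨?_, mul_pos hc hx.2⟩
  rw [lorentz_smul_left, lorentz_smul_right]
  exact mul_pos hc (mul_pos hc hx.1)

theorem sum_sq_lt_of_mem_futureCone {x : Fin (n + 1) → ℝ} (hx : x ∈ futureCone n) :
    ∑ i : Fin n, x i.succ ^ 2 < x 0 ^ 2 := by
  have := hx.1
  simp only [lorentz, ← sq] at this
  linarith

theorem lorentz_pos {x y : Fin (n + 1) → ℝ} (hx : x ∈ futureCone n) (hy : y ∈ futureCone n) :
    0 < lorentz x y := by
  have h : (∑ i : Fin n, x i.succ * y i.succ) ^ 2 < (x 0 * y 0) ^ 2 := by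
    rw [mul_pow]
    exact (Finset.sum_mul_sq_le_sq_mul_sq _ _ _).trans_lt
      (mul_lt_mul'' (sum_sq_lt_of_mem_futureCone hx) (sum_sq_lt_of_mem_futureCone hy)
        (by positivity) (by positivity))
  exact sub_pos.2 ((le_abs_self _).trans_lt (abs_lt_of_sq_lt_sq h (mul_pos hx.2 hy.2).le))

theorem add_mem_futureCone {x y : Fin (n + 1) → ℝ} (hx : x ∈ futureCone n)
    (hy : y ∈ futureCone n) : x + y ∈ futureCone n := by
  refine ⟨?_, add_pos hx.2 hy.2⟩
  rw [lorentz_add_left, lorentz_add_right, lorentz_add_right, lorentz_comm y x]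
  linarith [hx.1, hy.1, lorentz_pos hx hy]

/-- The form is negative definite on the orthogonal complement of a timelike vector. -/
theorem lorentz_self_neg {p v : Fin (n + 1) → ℝ} (hp : p ∈ futureCone n)
    (hpv : lorentz p v = 0) (hv : v ≠ 0) : lorentz v v < 0 := by
  have hcs := Finset.sum_mul_sq_le_sq_mul_sq Finset.univ (fun i : Fin n => p i.succ)
    (fun i => v i.succ)
  have hp0 := sum_sq_lt_of_mem_futureCone hp
  -- Orthogonality turns Cauchy-Schwarz into a bound on `v 0`, strict because `p` is timelike.
  have hpv' : ∑ i : Fin n, p i.succ * v i.succ = p 0 * v 0 := (sub_eq_zero.1 hpv).symm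
  rw [hpv', mul_pow] at hcs
  have hnn : 0 ≤ ∑ i : Fin n, v i.succ ^ 2 := by positivity
  have hpos : 0 < ∑ i : Fin n, v i.succ ^ 2 := by
    refine hnn.lt_of_ne fun h => hv ?_
    have hs : ∀ i : Fin n, v i.succ = 0 := fun i =>
      pow_eq_zero_iff two_ne_zero |>.1
        ((Finset.sum_eq_zero_iff_of_nonneg fun i _ => sq_nonneg (v i.succ)).1 h.symm i
          (Finset.mem_univ i))
    rw [← h, mul_zero] at hcs
    have h0 : p 0 ^ 2 * v 0 ^ 2 = 0 := le_antisymm hcs (by positivity)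
    have hv0 : v 0 = 0 := by simpa [hp.2.ne'] using h0
    exact funext (Fin.cases hv0 hs)
  have hlt : p 0 ^ 2 * v 0 ^ 2 < p 0 ^ 2 * ∑ i : Fin n, v i.succ ^ 2 :=
    hcs.trans_lt (mul_lt_mul_of_pos_right hp0 hpos)
  have := lt_of_mul_lt_mul_left hlt (sq_nonneg _)
  simp only [lorentz, ← sq]
  linarith

theorem lorentz_self_nonpos {p v : Fin (n + 1) → ℝ} (hp : p ∈ futureCone n)
    (hpv : lorentz p v = 0) : lorentz v v ≤ 0 := by
  rcases eq_or_ne v 0 with rfl | hv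
  · simp [lorentz]
  · exact (lorentz_self_neg hp hpv hv).le

theorem sub_lorentz_smul_mem_tangentSpace {x : Fin (n + 1) → ℝ} (hx : x ∈ space n)
    (z : Fin (n + 1) → ℝ) : z - lorentz x z • x ∈ tangentSpace x := by
  rw [mem_tangentSpace, sub_eq_add_neg, ← neg_smul, lorentz_add_right, lorentz_smul_right, hx.1]
  ring

/-- The reverse Cauchy-Schwarz inequality on the hyperboloid. -/
theorem one_le_lorentz {x z : Fin (n + 1) → ℝ} (hx : x ∈ space n) (hz : z ∈ space n) :
    1 ≤ lorentz x z := by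
  have hx' := space_subset_futureCone hx
  have hpos := lorentz_pos hx' (space_subset_futureCone hz)
  have h := lorentz_self_nonpos hx' (sub_lorentz_smul_mem_tangentSpace hx z)
  rw [sub_eq_add_neg, ← neg_smul, lorentz_add_right, lorentz_add_left, lorentz_add_left,
    lorentz_smul_right, lorentz_smul_right, lorentz_smul_left, lorentz_smul_left,
    lorentz_comm z x, hx.1, hz.1] at h
  nlinarith

/-! ### Tangent vectors and geodesics -/

theorem tangentNorm_sq {p v : Fin (n + 1) → ℝ} (hp : p ∈ space n) (hv : v ∈ tangentSpace p) :
    tangentNorm v ^ 2 = -lorentz v v :=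
  Real.sq_sqrt (neg_nonneg.2 (lorentz_self_nonpos (space_subset_futureCone hp) hv))

theorem tangentNorm_pos {p v : Fin (n + 1) → ℝ} (hp : p ∈ space n) (hv : v ∈ tangentSpace p)
    (hv0 : v ≠ 0) : 0 < tangentNorm v :=
  Real.sqrt_pos.2 (neg_pos.2 (lorentz_self_neg (space_subset_futureCone hp) hv hv0))

theorem lorentz_comb_self {p v : Fin (n + 1) → ℝ} (hp : p ∈ space n) (hv : v ∈ tangentSpace p)
    (a b : ℝ) : lorentz (a • p + b • v) (a • p + b • v) = a ^ 2 - b ^ 2 * tangentNorm v ^ 2 := by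
  rw [tangentNorm_sq hp hv]
  simp only [lorentz_add_left, lorentz_add_right, lorentz_smul_left, lorentz_smul_right,
    lorentz_comm v p, hp.1, mem_tangentSpace.1 hv]
  ring

theorem mem_space_of_lorentz_pos {p z : Fin (n + 1) → ℝ} (hp : p ∈ space n)
    (hz : lorentz z z = 1) (hpz : 0 < lorentz p z) : z ∈ space n := by
  refine ⟨hz, ?_⟩
  by_contra! h
  rcases h.lt_or_eq with h | h
  · have hneg : (-1 : ℝ) • z ∈ futureCone n := by
      refine ⟨?_, ?_⟩
      · rw [lorentz_smul_left, lorentz_smul_right, hz]; norm_num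
      · simpa using h
    have := lorentz_pos (space_subset_futureCone hp) hneg
    rw [lorentz_smul_right] at this
    linarith
  · have : 0 ≤ ∑ i : Fin n, z i.succ * z i.succ := Finset.sum_nonneg fun i _ => mul_self_nonneg _
    simp only [lorentz, h] at hz
    linarith

theorem geodesic_mem_space {p v : Fin (n + 1) → ℝ} (hp : p ∈ space n) (hv : v ∈ tangentSpace p)
    (t : ℝ) : geodesic p v t ∈ space n := by
  refine mem_space_of_lorentz_pos hp ?_ ?_
  · rw [geodesic, lorentz_comb_self hp hv]
    rcases eq_or_ne v 0 with rfl | hv0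
    · simp [tangentNorm, lorentz]
    · rw [div_pow, div_mul_cancel₀ _ (pow_ne_zero _ (tangentNorm_pos hp hv hv0).ne')]
      exact Real.cosh_sq_sub_sinh_sq _
  · rw [geodesic, lorentz_add_right, lorentz_smul_right, lorentz_smul_right, hp.1,
      mem_tangentSpace.1 hv, mul_zero, add_zero, mul_one]
    exact Real.cosh_pos _

theorem geodesic_zero_right {p v : Fin (n + 1) → ℝ} : geodesic p v 0 = p := by
  simp [geodesic]

/-- A point of the hyperboloid in the plane of `p` and `v` lies on the geodesic from `p` with
velocity `v`. -/
theorem mem_range_geodesic {p v z : Fin (n + 1) → ℝ} (hp : p ∈ space n)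
    (hv : v ∈ tangentSpace p) (hz : z ∈ space n) {a b : ℝ} (hzab : z = a • p + b • v) :
    z ∈ range (geodesic p v) := by
  -- Here `a = lorentz p z`; its positivity selects the right root of `a ^ 2 = 1 + (b * tangentNorm
  -- v) ^ 2`.
  have ha : 1 ≤ a := by
    have := one_le_lorentz hp hz
    rwa [hzab, lorentz_add_right, lorentz_smul_right, lorentz_smul_right, hp.1,
      mem_tangentSpace.1 hv, mul_zero, add_zero, mul_one] at this
  have hab : a ^ 2 = 1 + (b * tangentNorm v) ^ 2 := by
    have := hz.1
    rw [hzab, lorentz_comb_self hp hv] at this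
    linarith [mul_pow b (tangentNorm v) 2]
  rcases eq_or_ne v 0 with rfl | hv0
  · have h1 : a = 1 := by
      simp only [tangentNorm, lorentz] at hab
      simp at hab
      exact hab.resolve_right (by linarith)
    exact ⟨0, by simp [geodesic_zero_right, hzab, h1]⟩
  · have hN := tangentNorm_pos hp hv hv0
    refine ⟨Real.arsinh (b * tangentNorm v) / tangentNorm v, ?_⟩
    rw [geodesic, mul_div_cancel₀ _ hN.ne', Real.cosh_arsinh, Real.sinh_arsinh, ← hab,
      Real.sqrt_sq (by linarith), mul_div_cancel_right₀ _ hN.ne', hzab]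

/-! ### Geodesic submanifolds as linear sections -/

/-- The positive cone over a set. -/
def coneOver (S : Set (Fin (n + 1) → ℝ)) : Set (Fin (n + 1) → ℝ) :=
  {z | ∃ c : ℝ, 0 < c ∧ ∃ s ∈ S, z = c • s}

section Submanifold

variable {r : ℕ} {S : Set (Fin (n + 1) → ℝ)}

theorem IsGeodesicSubmanifold.comb_mem (hS : IsGeodesicSubmanifold r S)
    {x y z : Fin (n + 1) → ℝ} (hx : x ∈ S) (hy : y ∈ S) (hz : z ∈ space n) {a b : ℝ}
    (hzab : z = a • x + b • y) : z ∈ S := by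
  have hxs := hS.subset_space hx
  have hys := hS.subset_space hy
  have hv := sub_lorentz_smul_mem_tangentSpace hxs y
  set v := y - lorentz x y • x with hvdef
  have hyv : y = lorentz x y • x + (1 : ℝ) • v := by rw [hvdef]; module
  have hzv : z = (a + b * lorentz x y) • x + b • v := by rw [hzab, hvdef]; module
  rcases eq_or_ne v 0 with hv0 | hv0
  · have := mem_range_geodesic hxs hv hz hzv
    rw [hv0] at this
    obtain ⟨t, rfl⟩ := this
    simpa [geodesic, tangentNorm, lorentz] using hx
  · have hxy : x ≠ y := by
      rintro rfl
      exact hv0 (by rw [hvdef, hxs.1, one_smul, sub_self])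
    exact hS.line_subset x hx y hy hxy _ ⟨x, hxs, v, hv, hv0, rfl⟩ ⟨0, geodesic_zero_right⟩
      (mem_range_geodesic hxs hv hys hyv) (mem_range_geodesic hxs hv hz hzv)

/-- Homogeneous form of `comb_mem`: normalize `z` to the hyperboloid and absorb the scalings into
the coefficients. -/
theorem IsGeodesicSubmanifold.comb_mem_coneOver (hS : IsGeodesicSubmanifold r S)
    {x y z : Fin (n + 1) → ℝ} (hx : x ∈ coneOver S) (hy : y ∈ coneOver S)
    (hz : z ∈ futureCone n) {a b : ℝ} (hzab : z = a • x + b • y) : z ∈ coneOver S := by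
  obtain ⟨c, -, s, hs, rfl⟩ := hx
  obtain ⟨d, -, s', hs', rfl⟩ := hy
  have hN : 0 < √(lorentz z z) := Real.sqrt_pos.2 hz.1
  have hz' : (√(lorentz z z))⁻¹ • z ∈ space n := by
    refine ⟨?_, (smul_mem_futureCone hz (inv_pos.2 hN)).2⟩
    rw [lorentz_smul_left, lorentz_smul_right]
    nth_rewrite 3 [← Real.mul_self_sqrt hz.1.le]
    field_simp
  refine ⟨√(lorentz z z), hN, _, hS.comb_mem hs hs' hz'
    (a := (√(lorentz z z))⁻¹ * a * c) (b := (√(lorentz z z))⁻¹ * b * d) ?_, ?_⟩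
  · generalize (√(lorentz z z))⁻¹ = e
    rw [hzab]
    module
  · rw [smul_inv_smul₀ hN.ne']

theorem subset_coneOver : S ⊆ coneOver S := fun x hx => ⟨1, one_pos, x, hx, (one_smul ℝ x).symm⟩

theorem IsGeodesicSubmanifold.coneOver_subset (hS : IsGeodesicSubmanifold r S) :
    coneOver S ⊆ futureCone n := by
  rintro _ ⟨c, hc, s, hs, rfl⟩
  exact smul_mem_futureCone (space_subset_futureCone (hS.subset_space hs)) hc

theorem exists_smul_add_mem_futureCone {p : Fin (n + 1) → ℝ} (hp : p ∈ space n)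
    (u : Fin (n + 1) → ℝ) : ∃ N : ℝ, N • p + u ∈ futureCone n := by
  have hp0 := hp.2
  -- The first three terms make `N * (N + 2 * lorentz p u) + lorentz u u` positive; the last handles
  -- the time coordinate.
  refine ⟨1 + 2 * |lorentz p u| + |lorentz u u| + |u 0| / p 0, ?_, ?_⟩
  · set N := 1 + 2 * |lorentz p u| + |lorentz u u| + |u 0| / p 0 with hN
    have h0 : 0 ≤ |u 0| / p 0 := by positivity
    have h1 := neg_abs_le (lorentz p u)
    have h2 := neg_abs_le (lorentz u u)
    have h3 := abs_nonneg (lorentz p u)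
    have h4 := abs_nonneg (lorentz u u)
    rw [lorentz_add_left, lorentz_add_right, lorentz_add_right, lorentz_smul_left,
      lorentz_smul_left, lorentz_smul_right, lorentz_smul_right, lorentz_comm u p, hp.1]
    have hN1 : 1 ≤ N := by linarith
    have hN2 : 1 + |lorentz u u| ≤ N + 2 * lorentz p u := by linarith
    nlinarith [mul_le_mul hN1 hN2 (by linarith) (by linarith)]
  · have h : (|u 0| / p 0) * p 0 = |u 0| := div_mul_cancel₀ _ hp0.ne'
    have h1 := neg_abs_le (u 0)
    have : 0 < (1 + 2 * |lorentz p u| + |lorentz u u|) * p 0 := by positivity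
    simp only [Pi.add_apply, Pi.smul_apply, smul_eq_mul]
    linarith

/-- A geodesic submanifold is the intersection of the hyperboloid with a linear subspace. -/
theorem IsGeodesicSubmanifold.exists_submodule (hS : IsGeodesicSubmanifold r S) :
    ∃ U : Submodule ℝ (Fin (n + 1) → ℝ), ∀ z, z ∈ S ↔ z ∈ space n ∧ z ∈ U := by
  obtain ⟨p, hp⟩ := hS.nonempty
  have hps := hS.subset_space hp
  have hpC := subset_coneOver hp
  -- The cone over `S` is closed only under combinations that stay timelike; adding a large multiple
  -- of `p` ensures this.
  let U : Submodule ℝ (Fin (n + 1) → ℝ) :=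
    { carrier := {u | ∃ N : ℝ, N • p + u ∈ coneOver S}
      zero_mem' := ⟨1, by simpa using hpC⟩
      add_mem' := by
        rintro u v ⟨N, hN⟩ ⟨M, hM⟩
        refine ⟨N + M, hS.comb_mem_coneOver hN hM ?_ (a := 1) (b := 1) (by module)⟩
        convert add_mem_futureCone (hS.coneOver_subset hN) (hS.coneOver_subset hM) using 1
        module
      smul_mem' := by
        rintro c u ⟨N, hN⟩
        obtain ⟨M, hM⟩ := exists_smul_add_mem_futureCone hps (c • u)
        exact ⟨M, hS.comb_mem_coneOver hN hpC hM (a := c) (b := M - c * N) (by module)⟩ }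
  refine ⟨U, fun z => ⟨fun hz => ⟨hS.subset_space hz, 0, ?_⟩, ?_⟩⟩
  · simpa using subset_coneOver hz
  · rintro ⟨hz, N, hN⟩
    obtain ⟨c, hc, s, hs, rfl⟩ := hS.comb_mem_coneOver hpC hN (space_subset_futureCone hz)
      (a := -N) (b := 1) (by module)
    exact hS.comb_mem hs hs hz (a := c) (b := 0) (by module)

theorem IsGeodesicSubmanifold.isRootedAt (hS : IsGeodesicSubmanifold r S)
    {m : Fin (n + 1) → ℝ} (hm : m ∈ S) : IsRootedAt r S m := by
  obtain ⟨U, hU⟩ := hS.exists_submodule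
  have hms := hS.subset_space hm
  have hmU := ((hU m).1 hm).2
  have hgeo : ∀ v ∈ U, v ∈ tangentSpace m → ∀ t, geodesic m v t ∈ S := fun v hv hvm t =>
    (hU _).2 ⟨geodesic_mem_space hms hvm t,
      U.add_mem (U.smul_mem _ hmU) (U.smul_mem _ hv)⟩
  have hT : tangentSpaceOf S m = U ⊓ tangentSpace m := by
    refine le_antisymm (Submodule.span_le.2 ?_) fun v hv =>
      Submodule.subset_span ⟨hv.2, hgeo v hv.1 hv.2⟩
    rintro v ⟨hvm, hv⟩
    refine ⟨?_, hvm⟩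
    rcases eq_or_ne v 0 with rfl | hv0
    · exact U.zero_mem
    have hN := tangentNorm_pos hms hvm hv0
    have h1 := ((hU _).1 (hv 1)).2
    -- The time-one point is a multiple of `m` plus a nonzero multiple of `v`, so `v` can be solved
    -- for within `U`.
    rw [geodesic, mul_one] at h1
    have hc : Real.sinh (tangentNorm v) / tangentNorm v ≠ 0 :=
      (div_pos (Real.sinh_pos_iff.2 hN) hN).ne'
    exact (U.smul_mem_iff hc).1 ((U.add_mem_iff_right (U.smul_mem _ hmU)).1 h1)
  refine ⟨hms, U ⊓ tangentSpace m, inf_le_right, hT ▸ hS.finrank_tangentSpaceOf m hm, ?_⟩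
  ext z
  simp only [mem_iUnion, exists_prop]
  constructor
  · intro hz
    have hv := sub_lorentz_smul_mem_tangentSpace hms z
    refine ⟨z - lorentz m z • m, ⟨U.sub_mem ((hU z).1 hz).2 (U.smul_mem _ hmU), hv⟩, ?_⟩
    exact mem_range_geodesic hms hv (hS.subset_space hz) (a := lorentz m z) (b := 1) (by module)
  · rintro ⟨v, ⟨hvU, hvm⟩, t, rfl⟩
    exact hgeo v hvU hvm t

end Submanifold

/-! ### Orthogonal splitting and local minimizers -/

/-- Orthogonal decomposition along a subspace that contains a timelike vector. -/
theorem exists_add_orthogonal {p : Fin (n + 1) → ℝ} (hp : p ∈ futureCone n)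
    {U : Submodule ℝ (Fin (n + 1) → ℝ)} (hpU : p ∈ U) (z : Fin (n + 1) → ℝ) :
    ∃ u ∈ U, ∃ w, (∀ v ∈ U, lorentz v w = 0) ∧ z = u + w := by
  have hsymm : (lorentzForm n).IsRefl := fun x y h => (lorentz_comm y x).trans h
  -- A common vector is null and orthogonal to the timelike `p`, hence zero.
  have hdisj : Disjoint U ((lorentzForm n).orthogonal U) := by
    rw [Submodule.disjoint_def]
    intro v hv hv'
    by_contra hv0
    exact (lorentz_self_neg hp (hv' p hpU) hv0).ne (hv' v hv)
  have hcod := ((lorentzForm n).isCompl_orthogonal_iff_disjoint hsymm).2 hdisj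
  obtain ⟨u, hu, w, hw, h⟩ := Submodule.mem_sup.1
    (hcod.sup_eq_top ▸ Submodule.mem_top : z ∈ U ⊔ (lorentzForm n).orthogonal U)
  exact ⟨u, hu, w, fun v hv => hw v hv, h.symm⟩

/-- Off the submanifold cut out by `U`, some points arbitrarily close to `m` are strictly closer
to all points of that submanifold. -/
theorem frequently_lorentz_lt {U : Submodule ℝ (Fin (n + 1) → ℝ)} {p m : Fin (n + 1) → ℝ}
    (hp : p ∈ space n) (hpU : p ∈ U) (hm : m ∈ space n) (hmU : m ∉ U) :
    ∃ᶠ z in 𝓝[space n] m, ∀ x ∈ space n, x ∈ U → lorentz x z < lorentz x m := by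
  obtain ⟨u, hu, w, hw, rfl⟩ := exists_add_orthogonal (space_subset_futureCone hp) hpU m
  have hw0 : w ≠ 0 := by
    rintro rfl
    exact hmU (by simpa using hu)
  have hww := lorentz_self_neg (space_subset_futureCone hp) (hw p hpU) hw0
  have huw := hw u hu
  have hsum : lorentz u u + lorentz w w = 1 := by
    have := hm.1
    rw [lorentz_add_left, lorentz_add_right, lorentz_add_right, lorentz_comm w u, huw] at this
    linarith
  have hself (s : ℝ) : lorentz (u + s • w) (u + s • w) = 1 - (1 - s ^ 2) * lorentz w w := by
    rw [lorentz_add_left, lorentz_add_right, lorentz_add_right, lorentz_comm (s • w) u,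
      lorentz_smul_right, lorentz_smul_left, lorentz_smul_right, huw]
    linear_combination hsum
  let q : ℝ → ℝ := fun s => 1 - (1 - s ^ 2) * lorentz w w
  -- Pairing with `U` does not see `w`, so only the factor `(√(q s))⁻¹ < 1` changes it when `s < 1`.
  let f : ℝ → Fin (n + 1) → ℝ := fun s => (√(q s))⁻¹ • (u + s • w)
  have hq : ∀ᶠ s in 𝓝[<] (1 : ℝ), 1 < q s := by
    filter_upwards [Ioo_mem_nhdsLT (show (0 : ℝ) < 1 by norm_num)] with s hs
    have : 0 < 1 - s ^ 2 := by nlinarith [hs.1, hs.2]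
    simp only [q]
    nlinarith
  have hf1 : f 1 = u + w := by simp [f, q]
  have hfc : Tendsto f (𝓝[<] 1) (𝓝 (u + w)) := by
    have hqc : ContinuousAt (fun s => √(q s)) 1 := by fun_prop
    have hc : ContinuousAt f 1 :=
      (hqc.inv₀ (by simp [q])).smul (by fun_prop : ContinuousAt (fun s : ℝ => u + s • w) 1)
    rw [← hf1]
    exact hc.tendsto.mono_left nhdsWithin_le_nhds
  have hf (s : ℝ) (hs : 1 < q s) (x : Fin (n + 1) → ℝ) (hxU : x ∈ U) :
      lorentz x (f s) = (√(q s))⁻¹ * lorentz x (u + w) := by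
    simp only [f, lorentz_smul_right, lorentz_add_right, hw x hxU, mul_zero]
  have hlt (s : ℝ) (hs : 1 < q s) : (√(q s))⁻¹ < 1 :=
    inv_lt_one_of_one_lt₀ (Real.lt_sqrt_of_sq_lt (by simpa using hs))
  have hpos (s : ℝ) (hs : 1 < q s) : 0 < (√(q s))⁻¹ :=
    inv_pos.2 (Real.sqrt_pos.2 (one_pos.trans hs))
  have hlor {x : Fin (n + 1) → ℝ} (hx : x ∈ space n) : 0 < lorentz x (u + w) :=
    one_pos.trans_le (one_le_lorentz hx hm)
  have hfs : ∀ᶠ s in 𝓝[<] (1 : ℝ), f s ∈ space n := by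
    filter_upwards [hq] with s hs
    refine mem_space_of_lorentz_pos hp ?_ ?_
    · have hq0 : 0 < √(q s) := Real.sqrt_pos.2 (one_pos.trans hs)
      have : √(q s) * √(q s) = q s := Real.mul_self_sqrt (one_pos.trans hs).le
      simp only [f, lorentz_smul_left, lorentz_smul_right, hself]
      change (√(q s))⁻¹ * ((√(q s))⁻¹ * q s) = 1
      nth_rewrite 3 [← this]
      field_simp
    · rw [hf s hs p hpU]
      exact mul_pos (hpos s hs) (hlor hp)
  have hft : Tendsto f (𝓝[<] 1) (𝓝[space n] (u + w)) := tendsto_nhdsWithin_iff.2 ⟨hfc, hfs⟩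
  refine hft.frequently (Eventually.frequently ?_)
  filter_upwards [hq] with s hs x hx hxU
  rw [hf s hs x hxU]
  exact mul_lt_of_lt_one_left (hlor hx) (hlt s hs)

/-- A local minimizer of a sum of strictly increasing functions of the distances to points of a
geodesic submanifold lies in that submanifold. -/
theorem IsGeodesicSubmanifold.mem_of_isLocalMinOn {r k : ℕ} {S : Set (Fin (n + 1) → ℝ)}
    (hS : IsGeodesicSubmanifold r S) {x : Fin k → Fin (n + 1) → ℝ} (hx : ∀ i, x i ∈ S)
    (hk : 0 < k) {g : ℝ → ℝ} (hg : StrictMonoOn g (Ici 1)) {m : Fin (n + 1) → ℝ}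
    (hm : m ∈ space n) (hmin : IsLocalMinOn (fun z => ∑ i, g (lorentz (x i) z)) (space n) m) :
    m ∈ S := by
  obtain ⟨U, hU⟩ := hS.exists_submodule
  by_contra hmS
  have hmU : m ∉ U := fun h => hmS ((hU m).2 ⟨hm, h⟩)
  have hxU (i) := (hU _).1 (hx i)
  have hfr := frequently_lorentz_lt (hxU ⟨0, hk⟩).1 (hxU ⟨0, hk⟩).2 hm hmU
  obtain ⟨z, hz, hle, hzs⟩ := (hfr.and_eventually (hmin.and self_mem_nhdsWithin)).exists
  refine hle.not_gt (Finset.sum_lt_sum_of_nonempty ⟨⟨0, hk⟩, Finset.mem_univ _⟩ fun i _ => ?_)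
  exact hg (one_le_lorentz (hxU i).1 hzs) (one_le_lorentz (hxU i).1 hm)
    (hz _ (hxU i).1 (hxU i).2)

/-! ### Existence of minimizers -/

theorem isClosed_space : IsClosed (space n) := by
  have : space n = {x | lorentz x x = 1} ∩ {x | 0 ≤ x 0} := by
    ext x
    refine ⟨fun h => ⟨h.1, h.2.le⟩, fun ⟨h, h0⟩ => ⟨h, lt_of_le_of_ne h0 fun h0 => ?_⟩⟩
    have h' : lorentz x x = 1 := h
    have : 0 ≤ ∑ i : Fin n, x i.succ * x i.succ := Finset.sum_nonneg fun i _ => mul_self_nonneg _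
    simp only [lorentz, ← h0] at h'
    linarith
  rw [this]
  exact (isClosed_eq (by fun_prop) continuous_const).inter
    (isClosed_le continuous_const (by fun_prop))

theorem norm_le_apply_zero {z : Fin (n + 1) → ℝ} (hz : z ∈ space n) : ‖z‖ ≤ z 0 := by
  rw [pi_norm_le_iff_of_nonneg hz.2.le]
  refine Fin.cases (by simp [abs_of_pos hz.2]) fun i => ?_
  have h1 := sum_sq_lt_of_mem_futureCone (space_subset_futureCone hz)
  have h2 := Finset.single_le_sum (fun i _ => sq_nonneg (z (Fin.succ i))) (Finset.mem_univ i)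
  exact abs_le_of_sq_le_sq (h2.trans h1.le) hz.2.le

/-- Cauchy-Schwarz on the spatial parts allows `c` to be the gap between `x 0` and the spatial
length of `x`. -/
theorem exists_mul_norm_le_lorentz {x : Fin (n + 1) → ℝ} (hx : x ∈ futureCone n) :
    ∃ c > 0, ∀ z ∈ space n, c * ‖z‖ ≤ lorentz x z := by
  have hx1 := sum_sq_lt_of_mem_futureCone hx
  have hc : 0 < x 0 - √(∑ i : Fin n, x i.succ ^ 2) :=
    sub_pos.2 ((Real.sqrt_lt' hx.2).2 hx1)
  refine ⟨_, hc, fun z hz => ?_⟩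
  refine (mul_le_mul_of_nonneg_left (norm_le_apply_zero hz) hc.le).trans ?_
  have h1 := sum_sq_lt_of_mem_futureCone (space_subset_futureCone hz)
  have h2 := Real.sum_mul_le_sqrt_mul_sqrt Finset.univ (fun i : Fin n => x i.succ)
    (fun i => z i.succ)
  have h3 : √(∑ i : Fin n, z i.succ ^ 2) ≤ z 0 := (Real.sqrt_le_left hz.2.le).2 h1.le
  have h4 := mul_le_mul_of_nonneg_left h3 (Real.sqrt_nonneg (∑ i : Fin n, x i.succ ^ 2))
  rw [lorentz, sub_mul]
  linarith

/-- All terms are nonnegative, so coercivity of a single one suffices. -/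
theorem exists_isMinOn_sum {k : ℕ} {x : Fin k → Fin (n + 1) → ℝ} (hx : ∀ i, x i ∈ space n)
    (hk : 0 < k) {g : ℝ → ℝ} (hgc : ContinuousOn g (Ici 1)) (hg0 : ∀ t ∈ Ici 1, 0 ≤ g t)
    (hg : Tendsto g atTop atTop) :
    ∃ m ∈ space n, IsMinOn (fun z => ∑ i, g (lorentz (x i) z)) (space n) m := by
  let i₀ : Fin k := ⟨0, hk⟩
  refine ContinuousOn.exists_isMinOn' (x₀ := x i₀) ?_ isClosed_space (hx i₀) ?_
  · refine continuousOn_finsetSum _ fun i _ => hgc.comp ?_ fun z hz => one_le_lorentz (hx i) hz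
    exact Continuous.continuousOn (by fun_prop)
  obtain ⟨c, hc, hcz⟩ := exists_mul_norm_le_lorentz (space_subset_futureCone (hx i₀))
  have hmem : ∀ᶠ z in cocompact (Fin (n + 1) → ℝ) ⊓ 𝓟 (space n), z ∈ space n :=
    mem_inf_of_right (mem_principal_self _)
  have hlor : Tendsto (lorentz (x i₀)) (cocompact (Fin (n + 1) → ℝ) ⊓ 𝓟 (space n)) atTop :=
    tendsto_atTop_mono' _ (hmem.mono hcz)
      (((tendsto_norm_cocompact_atTop (E := Fin (n + 1) → ℝ)).const_mul_atTop hc).mono_left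
        inf_le_left)
  filter_upwards [(hg.comp hlor).eventually_ge_atTop (∑ i, g (lorentz (x i) (x i₀))), hmem]
    with z hz hzs
  exact hz.trans (Finset.single_le_sum (f := fun i => g (lorentz (x i) z))
    (fun i _ => hg0 _ (one_le_lorentz (hx i) hzs)) (Finset.mem_univ i₀))

theorem IsGeodesicSubmanifold.exists_isMinOn {r k : ℕ} {S : Set (Fin (n + 1) → ℝ)}
    (hS : IsGeodesicSubmanifold r S) {x : Fin k → Fin (n + 1) → ℝ} (hx : ∀ i, x i ∈ S)
    {g : ℝ → ℝ} (hgm : StrictMonoOn g (Ici 1)) (hgc : ContinuousOn g (Ici 1))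
    (hg0 : ∀ t ∈ Ici 1, 0 ≤ g t) (hg : Tendsto g atTop atTop) :
    ∃ m ∈ S, IsMinOn (fun z => ∑ i, g (lorentz (x i) z)) (space n) m := by
  rcases k.eq_zero_or_pos with rfl | hk
  · obtain ⟨p, hp⟩ := hS.nonempty
    exact ⟨p, hp, fun z _ => by simp⟩
  · obtain ⟨m, hm, hmin⟩ :=
      exists_isMinOn_sum (fun i => hS.subset_space (hx i)) hk hgc hg0 hg
    exact ⟨m, hS.mem_of_isLocalMinOn hx hk hgm hm (hmin.localize), hmin⟩

/-! ### The profiles `g` of the two variances -/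

theorem strictMonoOn_arcosh_sq : StrictMonoOn (fun t => Real.arcosh t ^ 2) (Ici 1) := by
  intro s hs t ht hst
  have hs' : (1 : ℝ) ≤ s := hs
  exact pow_lt_pow_left₀ ((Real.arcosh_lt_arcosh (by linarith) (by linarith)).2 hst)
    (Real.arcosh_nonneg hs) two_ne_zero

theorem tendsto_arcosh_atTop : Tendsto Real.arcosh atTop atTop := by
  refine tendsto_atTop_mono' _ ?_ Real.tendsto_log_atTop
  filter_upwards [eventually_gt_atTop 0] with t ht
  exact Real.log_le_log ht (le_add_of_nonneg_right (Real.sqrt_nonneg _))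

theorem sinh_arcosh_sq {t : ℝ} (ht : 1 ≤ t) : Real.sinh (Real.arcosh t) ^ 2 = t ^ 2 - 1 := by
  rw [Real.sinh_sq, Real.cosh_arcosh ht]

theorem strictMonoOn_sinh_arcosh_sq :
    StrictMonoOn (fun t => Real.sinh (Real.arcosh t) ^ 2) (Ici 1) := by
  intro s hs t ht hst
  have hs' : (1 : ℝ) ≤ s := hs
  simp only [sinh_arcosh_sq hs, sinh_arcosh_sq ht]
  nlinarith

theorem tendsto_sinh_atTop : Tendsto Real.sinh atTop atTop :=
  Real.sinhOrderIso.tendsto_atTop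

end Hyperboloid

open Hyperboloid in
theorem mainTheorem5 (n r k : ℕ) (S : Set (Fin (n + 1) → ℝ))
    (hS : Hyperboloid.IsGeodesicSubmanifold r S)
    (x : Fin k → Fin (n + 1) → ℝ) (hx : ∀ i, x i ∈ S) :
    (∃ m ∈ S, Hyperboloid.IsKarcherMean x m ∧ Hyperboloid.IsRootedAt r S m) ∧
    (∃ m ∈ S, Hyperboloid.IsPseudoEuclideanMean x m ∧ Hyperboloid.IsRootedAt r S m) ∧
    (0 < k → ∀ m ∈ Hyperboloid.space n,
      IsLocalMinOn (Hyperboloid.frechetVariance x) (Hyperboloid.space n) m ∨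
        IsLocalMinOn (Hyperboloid.pseudoEuclideanVariance x) (Hyperboloid.space n) m →
      m ∈ S ∧ Hyperboloid.IsRootedAt r S m) := by
  refine ⟨?_, ?_, fun hk m hm hmin => ?_⟩
  · obtain ⟨m, hm, hmin⟩ := hS.exists_isMinOn hx strictMonoOn_arcosh_sq
      (Real.continuousOn_arcosh.pow 2) (fun _ _ => sq_nonneg _)
      ((Filter.tendsto_pow_atTop two_ne_zero).comp tendsto_arcosh_atTop)
    exact ⟨m, hm, ⟨hS.subset_space hm, hmin⟩, hS.isRootedAt hm⟩
  · obtain ⟨m, hm, hmin⟩ := hS.exists_isMinOn hx strictMonoOn_sinh_arcosh_sq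
      ((Real.continuous_sinh.comp_continuousOn Real.continuousOn_arcosh).pow 2)
      (fun _ _ => sq_nonneg _)
      ((Filter.tendsto_pow_atTop two_ne_zero).comp
        (tendsto_sinh_atTop.comp tendsto_arcosh_atTop))
    exact ⟨m, hm, ⟨hS.subset_space hm, hmin⟩, hS.isRootedAt hm⟩
  · have hmS : m ∈ S := hmin.elim
      (fun h => hS.mem_of_isLocalMinOn hx hk strictMonoOn_arcosh_sq hm h)
      (fun h => hS.mem_of_isLocalMinOn hx hk strictMonoOn_sinh_arcosh_sq hm h)
    exact ⟨hmS, hS.isRootedAt hmS⟩
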